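/- Let $k\ge 1$ be an integer. A $\mathbb{Z}^k$-action $(X,\mathbb{Z}^k)$ means an action of $\mathbb{Z}^k$ by homeomorphisms on a compact metric space $(X,d)$. Write $[n]=\{0,\dots,n-1\}^k\subset\mathbb{Z}^k$. We use the following notions. The order of a finite open cover $\alpha$ of $X$ is $\mathrm{ord}(\alpha)=-1+\max_{x\in X}\#\{U\in\alpha: x\in U\}$, and the Lebesgue covering dimension $\dim X$ is $\sup_\alpha\min_\beta \mathrm{ord}(\beta)$, where $\alpha$ runs over the finite open covers of $X$ and $\beta$ over the finite open covers such that every member of $\beta$ is contained in a member of $\alpha$. The mean dimension is $$\mathrm{mdim}(X)=\sup_{\epsilon>0}\lim_{n\to\infty}\frac{\mathrm{Widim}_\epsilon(X,d_{[n]})}{n^k},\qquad d_{[n]}(x,y)=\max_{g\in[n]}d(gx,gy),$$ where $\mathrm{Widim}_\epsilon(X,\rho)$ is the smallest integer $m\ge 0$ such that $X$ has a finite open cover of order at most $m$ whose members have $\rho$-diameter at most $\epsilon$ (the limit always exists). The Rokhlin dimension $\dim_{Rok}(X,\mathbb{Z}^k)$ is the smallest integer $d\ge0$ such that for every $n\ge1$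 there are open sets $U_0,\dots,U_d\subset X$ such that for each $i$ the sets $g\overline{U_i}$, $g\in[n]$, are pairwise disjoint, and $\bigcup_{i=0}^d\bigcup_{g\in[n]}gU_i=X$; it is $\infty$ if there is no such $d$. The action is free if $gx=x$ for some $x\in X$ implies $g=0$. $(X,\mathbb{Z}^k)$ is an extension of $(Y,\mathbb{Z}^k)$ if there is a continuous equivariant surjection $X\to Y$. For $m\ge1$, $\sigma$ denotes the shift action $\sigma(g,(x_n)_{n\in\mathbb{Z}^k})=(x_{n+g})_{n\in\mathbb{Z}^k}$ on $([0,1]^m)^{\mathbb{Z}^k}$, and an embedding of $(X,\mathbb{Z}^k)$ into $(([0,1]^m)^{\mathbb{Z}^k},\sigma)$ is a continuous injective equivariant map. **Statement.** Let $D\ge0$ and $L\ge1$ be integers, and let $(X,\mathbb{Z}^k)$ be an extension of a free $\mathbb{Z}^k$-action $(Y,\mathbb{Z}^k)$. If $\mathrm{mdim}(X)<L/2$, $\dim_{Rok}(Y,\mathbb{Z}^k)=D$ and $Y$ has finite Lebesgue covering dimension, then there exists an embedding of $(X,\mathbb{Z}^k)$ into $\bigl(([0,1]^{(D+1)L+1})^{\mathbb{Z}^k},\sigma\bigr)$.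 -/

import Mathlib

open scoped ENNReal

noncomputable section

namespace ZkAction

/-! ### Covers, order, covering dimension -/

/-- A finite cover of `X` by open sets. -/
structure IsFiniteOpenCover {X : Type*} [TopologicalSpace X] (α : Set (Set X)) : Prop where
  finite : α.Finite
  isOpen : ∀ U ∈ α, IsOpen U
  sUnion_eq : ⋃₀ α = Set.univ

/-- `ord(α) = -1 + max_x #{U ∈ α : x ∈ U}`. The subtraction does not truncate for a cover, since
then every point lies in a member; on the empty space the supremum is `⊥` (dimension `-1`). -/
def coverOrder {X : Type*} (α : Set (Set X)) : WithBot ℕ∞ :=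
  ⨆ x : X, (({U | U ∈ α ∧ x ∈ U}.encard - 1 : ℕ∞) : WithBot ℕ∞)

/-- `β ≻ α`: every member of `β` is contained in some member of `α`. -/
def Refines {X : Type*} (β α : Set (Set X)) : Prop :=
  ∀ V ∈ β, ∃ U ∈ α, V ⊆ U

/-- Lebesgue covering dimension: the supremum over the finite open covers `α` of the least order
of a finite open cover refining `α`. -/
def coveringDim (X : Type*) [TopologicalSpace X] : WithBot ℕ∞ :=
  ⨆ (α : Set (Set X)) (_ : IsFiniteOpenCover α),
    ⨅ (β : Set (Set X)) (_ : IsFiniteOpenCover β ∧ Refines β α), coverOrder β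

/-! ### Mean dimension -/

/-- `Widim_ε(X, d)`: the least natural number `n` for which there is a finite open cover of order
at most `n` all of whose members have `d`-diameter at most `ε` (`⊤` if there is no such `n`). -/
def widim {X : Type*} [TopologicalSpace X] (ε : ℝ) (d : X → X → ℝ) : ℕ∞ :=
  ⨅ (n : ℕ) (_ : ∃ α : Set (Set X), IsFiniteOpenCover α ∧
      (∀ U ∈ α, ∀ x ∈ U, ∀ y ∈ U, d x y ≤ ε) ∧ coverOrder α ≤ ((n : ℕ∞) : WithBot ℕ∞)), (n : ℕ∞)

/-- The box `[n] = {0, …, n - 1}^k` in `ℤ^k`. -/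
def box (k n : ℕ) : Finset (Fin k → ℤ) :=
  Fintype.piFinset fun _ => Finset.Ico (0 : ℤ) (n : ℤ)

/-- `d_[n](x, y) = max_{g ∈ [n]} d(g x, g y)`. -/
def boxDist (k n : ℕ) {X : Type*} [MetricSpace X] [AddAction (Fin k → ℤ) X] (x y : X) : ℝ :=
  (((box k n).sup fun g => nndist (g +ᵥ x) (g +ᵥ y) : NNReal) : ℝ)

/-- Mean dimension `sup_{ε > 0} lim_n Widim_ε(X, d_[n]) / n^k` of a `ℤ^k`-action. The limit always
exists for a continuous action on a compact space, and is written here as a lower limit. -/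
def meanDim (k : ℕ) (X : Type*) [MetricSpace X] [AddAction (Fin k → ℤ) X] : ℝ≥0∞ :=
  ⨆ (ε : ℝ) (_ : 0 < ε), Filter.liminf
    (fun n : ℕ => ((widim ε (boxDist k n (X := X)) : ℕ∞) : ℝ≥0∞) / (n : ℝ≥0∞) ^ k) Filter.atTop

/-! ### Rokhlin dimension -/

/-- For every positive `n` there are `d + 1` open sets such that each of them induces an
`[n]`-tower (its closure has pairwise disjoint translates by `[n]`), and these towers together
cover the space. -/
def HasRokhlinTowers (k : ℕ) (X : Type*) [TopologicalSpace X] [AddAction (Fin k → ℤ) X]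
    (d : ℕ) : Prop :=
  ∀ n : ℕ, 0 < n → ∃ U : Fin (d + 1) → Set X,
    (∀ i, IsOpen (U i)) ∧
    (∀ i, ∀ g ∈ box k n, ∀ h ∈ box k n, g ≠ h →
      Disjoint ((fun x => g +ᵥ x) '' closure (U i)) ((fun x => h +ᵥ x) '' closure (U i))) ∧
    (⋃ i, ⋃ g ∈ box k n, (fun x => g +ᵥ x) '' U i) = Set.univ

/-- Topological Rokhlin dimension: the least `d` as above, `⊤` if there is none. -/
def rokhlinDim (k : ℕ) (X : Type*) [TopologicalSpace X] [AddAction (Fin k → ℤ) X] : ℕ∞ :=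
  ⨅ (d : ℕ) (_ : HasRokhlinTowers k X d), (d : ℕ∞)

/-! ### Free actions, factor maps, cubical shifts -/

/-- A free `ℤ^k`-action: only `0` fixes a point. -/
def IsFreeAction (k : ℕ) (X : Type*) [AddAction (Fin k → ℤ) X] : Prop :=
  ∀ (x : X) (g : Fin k → ℤ), g +ᵥ x = x → g = 0

/-- `π` exhibits `X` as an extension of `Y`: it is a continuous equivariant surjection. -/
structure IsFactorMap (k : ℕ) {X Y : Type*} [TopologicalSpace X] [TopologicalSpace Y]
    [AddAction (Fin k → ℤ) X] [AddAction (Fin k → ℤ) Y] (π : X → Y) : Prop where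
  continuous : Continuous π
  surjective : Function.Surjective π
  map_vadd : ∀ (g : Fin k → ℤ) (x : X), π (g +ᵥ x) = g +ᵥ π x

/-- The space `([0,1]^m)^{ℤ^k}`, with the product topology. -/
abbrev CubicalShift (k m : ℕ) : Type :=
  (Fin k → ℤ) → (Fin m → unitInterval)

/-- The shift `σ(g, (x_n)_n) = (x_{n+g})_n`. -/
def shift {k m : ℕ} (g : Fin k → ℤ) (x : CubicalShift k m) : CubicalShift k m :=
  fun n => x (n + g)

/-- An embedding of a `ℤ^k`-action into the `m`-cubical shift: a continuous injective equivariant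
map. -/
structure IsCubicalEmbedding {k m : ℕ} {X : Type*} [TopologicalSpace X]
    [AddAction (Fin k → ℤ) X] (f : X → CubicalShift k m) : Prop where
  continuous : Continuous f
  injective : Function.Injective f
  map_vadd : ∀ (g : Fin k → ℤ) (x : X), f (g +ᵥ x) = shift g (f x)

end ZkAction

end

/-! An equivariant map into a cubical shift has the form `x ↦ (f (g +ᵥ x))_g`, so the task is to
find `f : X → cube` that separates distinct points somewhere along their orbits. One coordinate, `h
∘ π`, handles pairs with different images in `Y`; `(D + 1) * L` others, `L` for each Rokhlin tower,
handle pairs in a common fibre. In both cases Baire category in `C(X, Z)` reduces the problem to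
separating a compact set of pairs by a small perturbation.

The engine is `exists_perturbation`, a Menger–Nöbeling argument along a tower. The values of `f`
over the levels `S` form one map of the base into a cube of dimension `|S| * |κ|`. If this is at
least `2 * m + 1`, where `m` bounds the order of a fine cover, then vertices in general position
make the nerve embed, so points with equal values share a member of the cover. For fibres, `S = [n]`
and mean dimension below `L / 2` supplies the inequality; on `Y`, freeness supplies `2 * d + 1`
suitable translates. -/

/-! ### General position in a cube. -/

/-- The points slide a small fraction `t` of the way to distinct points of the moment curve. Each
relevant minor is a polynomial in `t` that is a nonzero Vandermonde determinant at `t = 1`, so only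
finitely many `t` are bad. -/
theorem exists_generalPosition_fin {ι : Type*} [Fintype ι] {N : ℕ} (p : ι → Fin N → ℝ)
    (hp : ∀ i j, p i j ∈ Set.Icc (0 : ℝ) 1) {δ : ℝ} (hδ : 0 < δ) :
    ∃ v : ι → Fin N → ℝ, (∀ i j, v i j ∈ Set.Icc (0 : ℝ) 1) ∧ (∀ i j, |v i j - p i j| ≤ δ) ∧
      ∀ (T : Finset ι) (c : ι → ℝ), T.card ≤ N + 1 → (∀ i ∉ T, c i = 0) → ∑ i, c i = 0 →
        (∀ j, ∑ i, c i * v i j = 0) → c = 0 := by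
  classical
  let e := Fintype.equivFin ι
  -- Distinct nodes in `[0, 1]`, so the moment curve stays inside the cube.
  let τ : ι → ℝ := fun i => 1 / ((e i : ℝ) + 1)
  have hτinj : Function.Injective τ := by
    intro a b h
    have h2 : ((e a : ℕ) : ℝ) = (e b : ℕ) := by
      have : (1 / ((e a : ℝ) + 1))⁻¹ = (1 / ((e b : ℝ) + 1))⁻¹ := congrArg _ h
      simpa using this
    exact e.injective (Fin.ext (by exact_mod_cast h2))
  have hτ0 : ∀ i, 0 ≤ τ i := fun i => by positivity
  have hτ1 : ∀ i, τ i ≤ 1 := fun i => by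
    apply div_le_one_of_le₀ <;> [skip; positivity]
    linarith [(Nat.cast_nonneg (e i : ℕ) : (0:ℝ) ≤ _)]
  -- The prepended coordinate `1` turns affine independence into linear independence.
  let q : ι → Fin (N + 1) → ℝ := fun i => Fin.cons 1 (p i)
  -- Only the first `T.card` columns are kept: one nonsingular square minor already gives
  -- independent rows.
  let M : ∀ T : Finset ι, T.card ≤ N + 1 → Matrix (Fin T.card) (Fin T.card) (Polynomial ℝ) :=
    fun T hT => Matrix.of fun a b =>
      Polynomial.C (q (T.equivFin.symm a) (Fin.castLE hT b)) * (1 - Polynomial.X) +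
        Polynomial.C (τ (T.equivFin.symm a) ^ (b : ℕ)) * Polynomial.X
  have hdet : ∀ T hT, (M T hT).det ≠ 0 := by
    intro T hT h0
    have h1 : ((Polynomial.evalRingHom (1 : ℝ)).mapMatrix (M T hT)).det = 0 := by
      rw [← RingHom.map_det, h0, map_zero]
    have h2 : (Polynomial.evalRingHom (1 : ℝ)).mapMatrix (M T hT) =
        Matrix.vandermonde (fun a => τ (T.equivFin.symm a)) := by
      ext a b
      simp [M, Matrix.vandermonde]
    rw [h2] at h1
    refine Matrix.det_vandermonde_ne_zero_iff.2 ?_ h1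
    exact hτinj.comp (Subtype.val_injective.comp T.equivFin.symm.injective)
  let bad : Set ℝ := ⋃ (T : Finset ι), ⋃ (hT : T.card ≤ N + 1), {t | (M T hT).det.IsRoot t}
  have hbad : bad.Finite :=
    Set.finite_iUnion fun T => Set.finite_iUnion fun hT => Polynomial.finite_setOfPred_isRoot (hdet T hT)
  obtain ⟨t, ht, htb⟩ : ∃ t ∈ Set.Ioo (0 : ℝ) (min δ 1), t ∉ bad :=
    ((Set.Ioo_infinite (lt_min hδ one_pos)).sdiff hbad).nonempty
  have ht1 : t < 1 := ht.2.trans_le (min_le_right _ _)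
  have htδ : t < δ := ht.2.trans_le (min_le_left _ _)
  have hpow : ∀ i (j : Fin N), τ i ^ ((j : ℕ) + 1) ∈ Set.Icc (0 : ℝ) 1 := fun i j =>
    ⟨pow_nonneg (hτ0 i) _, pow_le_one₀ (hτ0 i) (hτ1 i)⟩
  refine ⟨fun i j => (1 - t) * p i j + t * τ i ^ ((j : ℕ) + 1), fun i j => ?_, fun i j => ?_, ?_⟩
  · exact convex_Icc (0 : ℝ) 1 (hp i j) (hpow i j) (by linarith) ht.1.le (by ring)
  · have h1 : (1 - t) * p i j + t * τ i ^ ((j : ℕ) + 1) - p i j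
        = t * (τ i ^ ((j : ℕ) + 1) - p i j) := by ring
    have h2 : |τ i ^ ((j : ℕ) + 1) - p i j| ≤ 1 := by
      have h3 := hp i j
      have h4 := hpow i j
      exact abs_le.2 ⟨by linarith [h3.2, h4.1], by linarith [h3.1, h4.2]⟩
    rw [h1, abs_mul, abs_of_pos ht.1]
    nlinarith [ht.1]
  · intro T c hT hc hsum hcv
    let A := (Polynomial.evalRingHom t).mapMatrix (M T hT)
    have hA : A.det ≠ 0 := by
      intro h
      refine htb (Set.mem_iUnion₂.2 ⟨T, hT, ?_⟩)
      rw [← RingHom.map_det] at h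
      exact h
    have hAe : ∀ a b, A a b = (1 - t) * q (T.equivFin.symm a) (Fin.castLE hT b) +
        t * τ (T.equivFin.symm a) ^ (b : ℕ) := by
      intro a b
      simp [A, M]
      ring
    have hall : ∀ b : Fin (N + 1), ∑ i, c i * ((1 - t) * q i b + t * τ i ^ (b : ℕ)) = 0 := by
      intro b
      refine Fin.cases ?_ (fun j => ?_) b
      · simpa [q] using hsum
      · simpa [q] using hcv j
    have hz : (fun a => c (T.equivFin.symm a)) = 0 := by
      apply Matrix.eq_zero_of_vecMul_eq_zero hA
      ext b
      have h1 := hall (Fin.castLE hT b)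
      rw [← Finset.sum_subset (Finset.subset_univ T)
        (fun i _ hi => by rw [hc i hi, zero_mul]), ← Finset.sum_coe_sort,
        ← Equiv.sum_comp T.equivFin.symm] at h1
      simp only [Matrix.vecMul, dotProduct, hAe, Pi.zero_apply]
      exact h1
    ext i
    by_cases hi : i ∈ T
    · simpa using congrFun hz (T.equivFin ⟨i, hi⟩)
    · exact hc i hi

/-- Finitely many points of a cube can be moved into general position inside the cube. -/
theorem exists_generalPosition {ι J : Type*} [Fintype ι] [Fintype J] (p : ι → J → ℝ)
    (hp : ∀ i j, p i j ∈ Set.Icc (0 : ℝ) 1) {δ : ℝ} (hδ : 0 < δ) :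
    ∃ v : ι → J → ℝ, (∀ i j, v i j ∈ Set.Icc (0 : ℝ) 1) ∧ (∀ i j, |v i j - p i j| ≤ δ) ∧
      ∀ (T : Finset ι) (c : ι → ℝ), T.card ≤ Fintype.card J + 1 → (∀ i ∉ T, c i = 0) →
        ∑ i, c i = 0 → (∀ j, ∑ i, c i * v i j = 0) → c = 0 := by
  let e := Fintype.equivFin J
  obtain ⟨v, h1, h2, h3⟩ := exists_generalPosition_fin (fun i j => p i (e.symm j))
    (fun i j => hp i _) hδ
  refine ⟨fun i j => v i (e j), fun i j => h1 i _, fun i j => by simpa using h2 i (e j),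
    fun T c hT hc hs hcv => h3 T c hT hc hs fun j => by simpa using hcv (e.symm j)⟩

/-! ### Perturbing a map along a tower. -/

namespace ZkAction

theorem card_filter_mem_le_of_coverOrder_le {X : Type*} {α : Set (Set X)} [Fintype α] {m : ℕ}
    (hm : coverOrder α ≤ ((m : ℕ∞) : WithBot ℕ∞)) (x : X) (T : Finset α)
    (hT : ∀ U ∈ T, x ∈ (U : Set X)) : T.card ≤ m + 1 := by
  classical
  have h1 : ((({U | U ∈ α ∧ x ∈ U}.encard - 1 : ℕ∞)) : WithBot ℕ∞) ≤ ((m : ℕ∞) : WithBot ℕ∞) :=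
    (le_iSup (fun x : X => (({U | U ∈ α ∧ x ∈ U}.encard - 1 : ℕ∞) : WithBot ℕ∞)) x).trans hm
  have h2 : {U | U ∈ α ∧ x ∈ U}.encard - 1 ≤ (m : ℕ∞) := WithBot.coe_le_coe.1 h1
  have h3 : {U | U ∈ α ∧ x ∈ U}.encard ≤ (m : ℕ∞) + 1 := tsub_le_iff_right.1 h2
  have h4 : (T.map (Function.Embedding.subtype _) : Set (Set X)) ⊆ {U | U ∈ α ∧ x ∈ U} := by
    intro U hU
    simp only [Finset.coe_map, Function.Embedding.subtype_apply, Set.mem_image, Finset.mem_coe] at hU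
    obtain ⟨V, hV, rfl⟩ := hU
    exact ⟨V.2, hT V hV⟩
  have h5 := (Set.encard_le_encard h4).trans h3
  rw [Set.encard_coe_eq_coe_finsetCard, Finset.card_map] at h5
  exact_mod_cast h5

open Set Topology Filter

/-- A map into a cube can be perturbed on a tower with closed base so that its values along the
tower determine the base point up to a cover of small order. -/
theorem exists_perturbation {Γ X κ : Type*} [AddGroup Γ] [TopologicalSpace X] [NormalSpace X]
    [AddAction Γ X] [ContinuousConstVAdd Γ X] [Fintype κ] (S : Finset Γ) {C : Set X}
    (hC : IsClosed C)
    (hdisj : ∀ g ∈ S, ∀ h ∈ S, g ≠ h →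
      Disjoint ((fun x => g +ᵥ x) '' C) ((fun x => h +ᵥ x) '' C))
    {α : Set (Set X)} (hα : IsFiniteOpenCover α) {m : ℕ}
    (hm : coverOrder α ≤ ((m : ℕ∞) : WithBot ℕ∞)) (hS : 2 * m + 1 ≤ S.card * Fintype.card κ)
    {F : X → κ → ℝ} (hF : Continuous F) (hF01 : ∀ x l, F x l ∈ Icc (0 : ℝ) 1)
    {δ : ℝ} (hδ : 0 < δ)
    (hosc : ∀ U ∈ α, ∀ x ∈ U, ∀ y ∈ U, ∀ g ∈ S, ∀ l, |F (g +ᵥ x) l - F (g +ᵥ y) l| ≤ δ) :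
    ∃ F' : X → κ → ℝ, Continuous F' ∧ (∀ x l, F' x l ∈ Icc (0 : ℝ) 1) ∧
      (∀ x l, |F' x l - F x l| ≤ 2 * δ) ∧
      ∀ x ∈ C, ∀ y ∈ C, (∀ g ∈ S, F' (g +ᵥ x) = F' (g +ᵥ y)) → ∃ U ∈ α, x ∈ U ∧ y ∈ U := by
  classical
  have : Fintype α := hα.finite.fintype
  have hp : ∀ U : α, ∃ p : S × κ → ℝ, (∀ j, p j ∈ Icc (0 : ℝ) 1) ∧
      ∀ x ∈ (U : Set X), ∀ j, |F (j.1.1 +ᵥ x) j.2 - p j| ≤ δ := by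
    intro U
    by_cases hU : (U : Set X).Nonempty
    · obtain ⟨z, hz⟩ := hU
      exact ⟨fun j => F (j.1.1 +ᵥ z) j.2, fun j => hF01 _ _,
        fun x hx j => hosc U U.2 x hx z hz j.1.1 j.1.2 j.2⟩
    · exact ⟨fun _ => 0, fun _ => by simp, fun x hx => (hU ⟨x, hx⟩).elim⟩
  choose p hp01 hpF using hp
  obtain ⟨v, hv01, hvp, hgen⟩ := exists_generalPosition p hp01 hδ
  obtain ⟨ψ, hψ⟩ := PartitionOfUnity.exists_isSubordinate_of_locallyFinite (isClosed_univ (X := X))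
    (fun U : α => (U : Set X)) (fun U => hα.isOpen U U.2) (locallyFinite_of_finite _)
    (by rw [← sUnion_eq_iUnion, hα.sUnion_eq])
  have hψsum : ∀ x, ∑ U, ψ U x = 1 := fun x => by
    rw [← finsum_eq_sum_of_fintype]
    exact ψ.sum_eq_one (mem_univ x)
  have hψmem : ∀ U x, ψ U x ≠ 0 → x ∈ (U : Set X) := fun U x h =>
    hψ U (subset_tsupport _ h)
  -- The canonical map to the nerve, followed by the affine map sending its vertices to the `v U`.
  let G : X → S × κ → ℝ := fun x j => ∑ U, ψ U x * v U j
  have hGc : ∀ j, Continuous fun x => G x j := fun j =>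
    continuous_finsetSum _ fun U _ => (ψ U).continuous.mul continuous_const
  have hG01 : ∀ x j, G x j ∈ Icc (0 : ℝ) 1 := fun x j => by
    have := (convex_Icc (0 : ℝ) 1).sum_mem (t := Finset.univ) (w := fun U => ψ U x)
      (z := fun U => v U j) (fun U _ => ψ.nonneg U x) (hψsum x) (fun U _ => hv01 U j)
    simpa [G] using this
  have hGF : ∀ x (j : S × κ), |G x j - F (j.1.1 +ᵥ x) j.2| ≤ 2 * δ := fun x j => by
    have h1 : G x j - F (j.1.1 +ᵥ x) j.2 = ∑ U, ψ U x * (v U j - F (j.1.1 +ᵥ x) j.2) := by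
      simp only [mul_sub, Finset.sum_sub_distrib, ← Finset.sum_mul, hψsum, one_mul, G]
    rw [h1]
    calc _ ≤ ∑ U, |ψ U x * (v U j - F (j.1.1 +ᵥ x) j.2)| := Finset.abs_sum_le_sum_abs _ _
      _ ≤ ∑ U, ψ U x * (2 * δ) := by
        refine Finset.sum_le_sum fun U _ => ?_
        rw [abs_mul, abs_of_nonneg (ψ.nonneg U x)]
        by_cases h0 : ψ U x = 0
        · simp [h0]
        · refine mul_le_mul_of_nonneg_left ?_ (ψ.nonneg U x)
          have h2 := hpF U x (hψmem U x h0) j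
          have h3 := hvp U j
          rw [abs_le] at *
          constructor <;> linarith [h2.1, h2.2, h3.1, h3.2]
      _ = 2 * δ := by rw [← Finset.sum_mul, hψsum, one_mul]
  have himg : ∀ g : Γ, IsClosed ((fun x => g +ᵥ x) '' C) := fun g =>
    (Homeomorph.vadd g).isClosedMap C hC
  -- The support of `θ g` avoids all other levels of the tower, so on level `g` it equals `1` and
  -- the rest vanish.
  obtain ⟨θ, hθ⟩ := PartitionOfUnity.exists_isSubordinate_of_locallyFinite
    (s := ⋃ g : S, (fun x => g.1 +ᵥ x) '' C) (isClosed_iUnion_of_finite fun g => himg g)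
    (fun g : S => (⋃ h : {h : S // h ≠ g}, (fun x => h.1.1 +ᵥ x) '' C)ᶜ)
    (fun g => (isClosed_iUnion_of_finite fun h : {h : S // h ≠ g} => himg h.1.1).isOpen_compl)
    (locallyFinite_of_finite _) (by
      intro z hz
      obtain ⟨g, hg⟩ := mem_iUnion.1 hz
      refine mem_iUnion.2 ⟨g, fun hz' => ?_⟩
      obtain ⟨h, hh⟩ := mem_iUnion.1 hz'
      exact disjoint_left.1 (hdisj g g.2 h.1 h.1.2 fun e => h.2 (Subtype.ext e.symm)) hg hh)
  have hθle : ∀ x, ∑ g, θ g x ≤ 1 := fun x => by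
    rw [← finsum_eq_sum_of_fintype]
    exact θ.sum_le_one x
  have hθ0 : ∀ (g h : S), h ≠ g → ∀ x ∈ C, θ h (g.1 +ᵥ x) = 0 := by
    intro g h hgh x hx
    by_contra h0
    exact hθ h (subset_tsupport _ h0) (mem_iUnion.2 ⟨⟨g, hgh.symm⟩, mem_image_of_mem _ hx⟩)
  have hθ1 : ∀ (g : S), ∀ x ∈ C, θ g (g.1 +ᵥ x) = 1 := by
    intro g x hx
    have h1 := θ.sum_eq_one (x := g.1 +ᵥ x) (mem_iUnion.2 ⟨g, mem_image_of_mem _ hx⟩)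
    rw [finsum_eq_sum_of_fintype, Finset.sum_eq_single g (fun h _ hh => hθ0 g h hh x hx)
      (fun h => (h (Finset.mem_univ g)).elim)] at h1
    exact h1
  -- On level `g` the new map reads off block `g` of `G` at the base point; off the tower it is a
  -- convex blend with `F`.
  refine ⟨fun x l => F x l + ∑ g : S, θ g x * (G (-g.1 +ᵥ x) (g, l) - F x l), ?_, ?_, ?_, ?_⟩
  · have hFl : ∀ l, Continuous fun x => F x l := fun l => (continuous_apply l).comp hF
    refine continuous_pi fun l => (hFl l).add (continuous_finsetSum _ fun g _ =>
      (θ g).continuous.mul (((hGc (g, l)).comp (continuous_const_vadd (-g.1))).sub (hFl l)))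
  · intro x l
    have h1 : F x l + ∑ g : S, θ g x * (G (-g.1 +ᵥ x) (g, l) - F x l) =
        (1 - ∑ g, θ g x) * F x l + ∑ g : S, θ g x * G (-g.1 +ᵥ x) (g, l) := by
      simp only [mul_sub, Finset.sum_sub_distrib, ← Finset.sum_mul]
      ring
    have hs := hθle x
    have hFx := hF01 x l
    have h2 : 0 ≤ ∑ g : S, θ g x * G (-g.1 +ᵥ x) (g, l) :=
      Finset.sum_nonneg fun g _ => mul_nonneg (θ.nonneg g x) (hG01 _ _).1
    have h3 : ∑ g : S, θ g x * G (-g.1 +ᵥ x) (g, l) ≤ ∑ g, θ g x :=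
      Finset.sum_le_sum fun g _ => mul_le_of_le_one_right (θ.nonneg g x) (hG01 _ _).2
    show _ + _ ∈ _
    rw [h1]
    constructor
    · have := mul_nonneg (sub_nonneg.2 hs) hFx.1
      linarith
    · have := mul_le_of_le_one_right (sub_nonneg.2 hs) hFx.2
      linarith
  · intro x l
    rw [add_sub_cancel_left]
    calc _ ≤ ∑ g : S, |θ g x * (G (-g.1 +ᵥ x) (g, l) - F x l)| := Finset.abs_sum_le_sum_abs _ _
      _ ≤ ∑ g : S, θ g x * (2 * δ) := by
        refine Finset.sum_le_sum fun g _ => ?_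
        rw [abs_mul, abs_of_nonneg (θ.nonneg g x)]
        refine mul_le_mul_of_nonneg_left ?_ (θ.nonneg g x)
        simpa using hGF (-g.1 +ᵥ x) (g, l)
      _ ≤ 2 * δ := by
        rw [← Finset.sum_mul]
        exact mul_le_of_le_one_left (by positivity) (hθle x)
  · intro x hx y hy hxy
    have hval : ∀ z ∈ C, ∀ (g : S) l, F (g.1 +ᵥ z) l +
        ∑ h : S, θ h (g.1 +ᵥ z) * (G (-h.1 +ᵥ (g.1 +ᵥ z)) (h, l) - F (g.1 +ᵥ z) l) =
          G z (g, l) := by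
      intro z hz g l
      rw [Finset.sum_eq_single g (fun h _ hh => by rw [hθ0 g h hh z hz, zero_mul])
        (fun h => (h (Finset.mem_univ g)).elim), hθ1 g z hz, neg_vadd_vadd]
      ring
    have hG : ∀ j, G x j = G y j := by
      rintro ⟨g, l⟩
      rw [← hval x hx g l, ← hval y hy g l]
      exact congrFun (hxy g g.2) l
    let Tx : Finset α := Finset.univ.filter fun U => x ∈ (U : Set X)
    let Ty : Finset α := Finset.univ.filter fun U => y ∈ (U : Set X)
    have hTx := card_filter_mem_le_of_coverOrder_le hm x Tx (by simp [Tx])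
    have hTy := card_filter_mem_le_of_coverOrder_le hm y Ty (by simp [Ty])
    -- Two points meet at most `2 * (m + 1)` members together, which is the `|S| * |κ| + 1` vertices
    -- that general position allows at most. Hence `x` and `y` have equal barycentric coordinates.
    have hc := hgen (Tx ∪ Ty) (fun U => ψ U x - ψ U y) (by
        refine (Finset.card_union_le _ _).trans ?_
        rw [Fintype.card_prod, Fintype.card_coe]
        omega)
      (by
        intro U hU
        simp only [Finset.mem_union, not_or, Tx, Ty, Finset.mem_filter, Finset.mem_univ,
          true_and] at hU
        have h1 : ψ U x = 0 := by_contra fun h => hU.1 (hψmem U x h)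
        have h2 : ψ U y = 0 := by_contra fun h => hU.2 (hψmem U y h)
        simp [h1, h2])
      (by rw [Finset.sum_sub_distrib, hψsum, hψsum, sub_self])
      (fun j => by
        simp only [sub_mul, Finset.sum_sub_distrib]
        exact sub_eq_zero.2 (hG j))
    obtain ⟨U, -, hU⟩ : ∃ U ∈ Finset.univ, ψ U x ≠ 0 :=
      Finset.exists_ne_zero_of_sum_ne_zero (by rw [hψsum]; exact one_ne_zero)
    have hU' : ψ U y ≠ 0 := by
      have : ψ U x - ψ U y = 0 := congrFun hc U
      rwa [← sub_eq_zero.1 this]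
    exact ⟨U, U.2, hψmem U x hU, hψmem U y hU'⟩

theorem exists_perturbation_continuousMap {Γ X κ : Type*} [AddGroup Γ] [TopologicalSpace X]
    [CompactSpace X] [NormalSpace X] [AddAction Γ X] [ContinuousConstVAdd Γ X] [Fintype κ]
    (S : Finset Γ) {C : Set X} (hC : IsClosed C)
    (hdisj : ∀ g ∈ S, ∀ h ∈ S, g ≠ h →
      Disjoint ((fun x => g +ᵥ x) '' C) ((fun x => h +ᵥ x) '' C))
    {α : Set (Set X)} (hα : IsFiniteOpenCover α) {m : ℕ}
    (hm : coverOrder α ≤ ((m : ℕ∞) : WithBot ℕ∞)) (hS : 2 * m + 1 ≤ S.card * Fintype.card κ)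
    (f : C(X, κ → unitInterval)) {δ : ℝ} (hδ : 0 < δ)
    (hosc : ∀ U ∈ α, ∀ x ∈ U, ∀ y ∈ U, ∀ g ∈ S, dist (f (g +ᵥ x)) (f (g +ᵥ y)) ≤ δ) :
    ∃ f' : C(X, κ → unitInterval), dist f' f ≤ 2 * δ ∧
      ∀ x ∈ C, ∀ y ∈ C, (∀ g ∈ S, f' (g +ᵥ x) = f' (g +ᵥ y)) → ∃ U ∈ α, x ∈ U ∧ y ∈ U := by
  obtain ⟨F', hc, h01, hd, hsep⟩ := exists_perturbation S hC hdisj hα hm hS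
    (F := fun x l => (f x l : ℝ))
    (continuous_pi fun l => continuous_subtype_val.comp ((continuous_apply l).comp f.continuous))
    (fun x l => (f x l).2) hδ
    (fun U hU x hx y hy g hg l => (dist_le_pi_dist _ _ l).trans (hosc U hU x hx y hy g hg))
  refine ⟨⟨fun x l => ⟨F' x l, h01 x l⟩, continuous_pi fun l =>
    ((continuous_apply l).comp hc).subtype_mk _⟩, ?_, fun x hx y hy h => hsep x hx y hy ?_⟩
  · refine (ContinuousMap.dist_le (by positivity)).2 fun x =>
      (dist_pi_le_iff (by positivity)).2 fun l => hd x l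
  · intro g hg
    ext l
    exact congrArg Subtype.val (congrFun (h g hg) l)

/-! ### Baire category. -/

/-- If each compact set of pairs can be orbit-separated by a small perturbation of any map, then
countably many compact sets of pairs are orbit-separated by one map. -/
theorem exists_forall_orbit_separating {Γ X Z ι : Type*} [TopologicalSpace X]
    [CompactSpace X] [VAdd Γ X] [ContinuousConstVAdd Γ X] [MetricSpace Z] [CompleteSpace Z]
    [Nonempty Z] [Countable ι] (K : ι → Set (X × X)) (hK : ∀ i, IsCompact (K i))
    (hd : ∀ i (f : C(X, Z)) (ε : ℝ), 0 < ε → ∃ f' : C(X, Z), dist f' f ≤ ε ∧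
      ∀ p ∈ K i, ∃ g : Γ, f' (g +ᵥ p.1) ≠ f' (g +ᵥ p.2)) :
    ∃ f : C(X, Z), ∀ i, ∀ p ∈ K i, ∃ g : Γ, f (g +ᵥ p.1) ≠ f (g +ᵥ p.2) := by
  have hdense : Dense (⋂ i, {f : C(X, Z) | ∀ p ∈ K i, ∃ g : Γ, f (g +ᵥ p.1) ≠ f (g +ᵥ p.2)}) := by
    refine dense_iInter_of_isOpen (fun i => ?_) (fun i => ?_)
    -- Separation at a fixed `g` is open jointly in the map and the pair; compactness of `K i` makes
    -- it uniform over the pairs.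
    · refine isOpen_iff_eventually.2 fun f hf => ?_
      refine (hK i).eventually_forall_of_forall_eventually
        (P := fun (f : C(X, Z)) (p : X × X) => ∃ g : Γ, f (g +ᵥ p.1) ≠ f (g +ᵥ p.2)) fun p hp => ?_
      obtain ⟨g, hg⟩ := hf p hp
      have h1 : Continuous fun z : C(X, Z) × (X × X) => z.1 (g +ᵥ z.2.1) :=
        continuous_eval.comp (continuous_fst.prodMk (continuous_snd.fst.const_vadd g))
      have h2 : Continuous fun z : C(X, Z) × (X × X) => z.1 (g +ᵥ z.2.2) :=
        continuous_eval.comp (continuous_fst.prodMk (continuous_snd.snd.const_vadd g))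
      exact mem_of_superset ((isOpen_ne_fun h1 h2).mem_nhds (x := (f, p)) hg) fun z hz => ⟨g, hz⟩
    · refine Metric.dense_iff.2 fun f r hr => ?_
      obtain ⟨f', h1, h2⟩ := hd i f (r / 2) (half_pos hr)
      exact ⟨f', Metric.mem_ball.2 (by linarith), h2⟩
  have : Nonempty C(X, Z) := ⟨ContinuousMap.const X (Classical.arbitrary Z)⟩
  obtain ⟨f, hf⟩ := hdense.nonempty
  exact ⟨f, fun i => mem_iInter.1 hf i⟩

/-! ### Finite-dimensional free actions. -/

theorem exists_refinement_of_coveringDim_lt_top {Y : Type*} [TopologicalSpace Y]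
    (h : coveringDim Y < ⊤) : ∃ d : ℕ, ∀ α : Set (Set Y), IsFiniteOpenCover α →
      ∃ β, IsFiniteOpenCover β ∧ Refines β α ∧ coverOrder β ≤ ((d : ℕ∞) : WithBot ℕ∞) := by
  obtain ⟨d, hd⟩ : ∃ d : ℕ, coveringDim Y ≤ ((d : ℕ∞) : WithBot ℕ∞) := by
    generalize coveringDim Y = c at h
    induction c with
    -- Dimension `⊥` is replaced by the weaker bound `0`.
    | bot => exact ⟨0, bot_le⟩
    | coe c =>
      have hc : c ≠ ⊤ := by
        rintro rfl
        exact lt_irrefl _ h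
      obtain ⟨d, rfl⟩ := ENat.ne_top_iff_exists.1 hc
      exact ⟨d, le_rfl⟩
  refine ⟨d, fun α hα => ?_⟩
  have h1 : (⨅ (β : Set (Set Y)) (_ : IsFiniteOpenCover β ∧ Refines β α), coverOrder β) <
      (((d + 1 : ℕ) : ℕ∞) : WithBot ℕ∞) := by
    refine lt_of_le_of_lt ((le_iSup₂ (f := fun (α : Set (Set Y)) (_ : IsFiniteOpenCover α) =>
      ⨅ (β : Set (Set Y)) (_ : IsFiniteOpenCover β ∧ Refines β α), coverOrder β) α hα).trans hd) ?_
    exact WithBot.coe_lt_coe.2 (by exact_mod_cast Nat.lt_succ_self d)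
  obtain ⟨β, hβ⟩ := iInf_lt_iff.1 h1
  obtain ⟨⟨hβ1, hβ2⟩, hβ3⟩ := iInf_lt_iff.1 hβ
  refine ⟨β, hβ1, hβ2, ?_⟩
  generalize coverOrder β = c at hβ3
  induction c with
  | bot => exact bot_le
  | coe c =>
    refine WithBot.coe_le_coe.2 ?_
    have := WithBot.coe_lt_coe.1 hβ3
    exact ENat.lt_natCast_add_one_iff.1 (by exact_mod_cast this)

/-- A compact space has finite open covers on whose members a given continuous map into a metric
space varies little. -/
theorem exists_finiteOpenCover_dist_le {Y Z : Type*} [TopologicalSpace Y] [CompactSpace Y]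
    [PseudoMetricSpace Z] {φ : Y → Z} (hφ : Continuous φ) {ε : ℝ} (hε : 0 < ε) :
    ∃ α : Set (Set Y), IsFiniteOpenCover α ∧ ∀ U ∈ α, ∀ x ∈ U, ∀ y ∈ U, dist (φ x) (φ y) ≤ ε := by
  have ho : ∀ y, IsOpen (φ ⁻¹' Metric.ball (φ y) (ε / 2)) := fun y => Metric.isOpen_ball.preimage hφ
  obtain ⟨t, ht⟩ := CompactSpace.elim_nhds_subcover (fun y => φ ⁻¹' Metric.ball (φ y) (ε / 2))
    fun y => (ho y).mem_nhds (Metric.mem_ball_self (half_pos hε))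
  refine ⟨(fun y => φ ⁻¹' Metric.ball (φ y) (ε / 2)) '' t, ⟨t.finite_toSet.image _, ?_, ?_⟩, ?_⟩
  · rintro _ ⟨y, -, rfl⟩
    exact ho y
  · rw [sUnion_image]
    exact ht
  · rintro _ ⟨z, -, rfl⟩ x hx y hy
    have h1 := Metric.mem_ball.1 hx
    have h2 := Metric.mem_ball.1 hy
    linarith [dist_triangle_right (φ x) (φ y) (φ z)]

/-- By freeness at most one `u` carries `x` to `y`, and `u ≠ 0`. A coincidence `g +ᵥ x = h +ᵥ y`
forces `g - h = u`, which is impossible when `g` and `h` are even multiples of `u`. If the orbits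
differ, any nonzero `u` serves. -/
theorem exists_finset_disjoint_orbit {k : ℕ} (hk : 0 < k) {Y : Type*} [AddAction (Fin k → ℤ) Y]
    (hfree : IsFreeAction k Y) {x y : Y} (hxy : x ≠ y) (n : ℕ) :
    ∃ S : Finset (Fin k → ℤ), S.card = n ∧ ∀ g ∈ S, ∀ h ∈ S, g +ᵥ x ≠ h +ᵥ y := by
  obtain ⟨u, hu0, hu⟩ : ∃ u : Fin k → ℤ, u ≠ 0 ∧ ∀ g : Fin k → ℤ, g +ᵥ x = y → g = u := by
    by_cases h : ∃ g : Fin k → ℤ, g +ᵥ x = y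
    · obtain ⟨u, rfl⟩ := h
      refine ⟨u, ?_, fun g hg => ?_⟩
      · rintro rfl
        exact hxy (zero_vadd _ x).symm
      · have := hfree x (-u + g) (by rw [add_vadd, hg, neg_vadd_vadd])
        exact (neg_add_eq_zero.1 this).symm
    · exact ⟨fun _ => 1, fun h0 => one_ne_zero (congrFun h0 ⟨0, hk⟩), fun g hg => (h ⟨g, hg⟩).elim⟩
  obtain ⟨i, hi⟩ := Function.ne_iff.1 hu0
  have hinj : Function.Injective fun a : ℕ => ((2 * a : ℕ) : ℤ) • u := by
    intro a b h
    have h1 := congrFun h i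
    simp only [Pi.smul_apply, smul_eq_mul] at h1
    have := mul_right_cancel₀ hi h1
    omega
  refine ⟨(Finset.range n).map ⟨_, hinj⟩, by simp, ?_⟩
  intro g hg h hh e
  simp only [Finset.mem_map, Function.Embedding.coeFn_mk] at hg hh
  obtain ⟨a, -, rfl⟩ := hg
  obtain ⟨b, -, rfl⟩ := hh
  have h1 := hu (-(((2 * b : ℕ) : ℤ) • u) + ((2 * a : ℕ) : ℤ) • u) (by
    rw [add_vadd, e, neg_vadd_vadd])
  have h2 := congrFun h1 i
  simp only [Pi.add_apply, Pi.neg_apply, Pi.smul_apply, smul_eq_mul] at h2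
  have h3 : (2 * (a : ℤ) - 2 * b - 1) * u i = 0 := by
    push_cast at h2
    linear_combination h2
  rcases mul_eq_zero.1 h3 with h4 | h4
  · omega
  · exact hi h4

/-- Distinct points have closed neighbourhoods that are orbit-separated by a small perturbation of
any function, on a finite-dimensional free action. -/
theorem exists_nhds_orbit_separating {k : ℕ} (hk : 0 < k) {Y : Type*} [MetricSpace Y]
    [CompactSpace Y] [AddAction (Fin k → ℤ) Y] [ContinuousConstVAdd (Fin k → ℤ) Y]
    (hfree : IsFreeAction k Y) (hdim : coveringDim Y < ⊤) {x y : Y} (hxy : x ≠ y) :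
    ∃ K ∈ 𝓝 (x, y), IsCompact K ∧ ∀ (f : C(Y, Fin 1 → unitInterval)) (ε : ℝ), 0 < ε →
      ∃ f' : C(Y, Fin 1 → unitInterval), dist f' f ≤ ε ∧
        ∀ p ∈ K, ∃ g : Fin k → ℤ, f' (g +ᵥ p.1) ≠ f' (g +ᵥ p.2) := by
  classical
  obtain ⟨d, hd⟩ := exists_refinement_of_coveringDim_lt_top hdim
  -- With a one-dimensional target, `2 * d + 1` levels are exactly what the perturbation needs.
  obtain ⟨S, hScard, hS⟩ := exists_finset_disjoint_orbit hk hfree hxy (2 * d + 1)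
  have hSx : ∀ z : Y, ∀ g h : Fin k → ℤ, g +ᵥ z = h +ᵥ z → g = h := fun z g h e => by
    have := hfree z (-h + g) (by rw [add_vadd, e, neg_vadd_vadd])
    exact (neg_add_eq_zero.1 this).symm
  let P : Finset Y := S.image (fun g => g +ᵥ x) ∪ S.image (fun g => g +ᵥ y)
  obtain ⟨r, hr, hrP⟩ : ∃ r : ℝ, 0 < r ∧ ∀ a ∈ P, ∀ b ∈ P, a ≠ b → 4 * r ≤ dist a b := by
    obtain ⟨r, hr, h⟩ : ∃ r : ℝ, 0 < r ∧ ∀ q ∈ P.offDiag, r ≤ dist q.1 q.2 := by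
      by_cases hne : P.offDiag.Nonempty
      · obtain ⟨q, hq, hmin⟩ := P.offDiag.exists_min_image (fun q => dist q.1 q.2) hne
        exact ⟨_, dist_pos.2 (Finset.mem_offDiag.1 hq).2.2, hmin⟩
      · exact ⟨1, one_pos, fun q hq => (hne ⟨q, hq⟩).elim⟩
    refine ⟨r / 4, by positivity, fun a ha b hb hab => ?_⟩
    have := h (a, b) (Finset.mem_offDiag.2 ⟨ha, hb, hab⟩)
    simp only at this
    linarith
  have hPx : ∀ g ∈ S, g +ᵥ x ∈ P := fun g hg =>
    Finset.mem_union_left _ (Finset.mem_image_of_mem _ hg)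
  have hPy : ∀ g ∈ S, g +ᵥ y ∈ P := fun g hg =>
    Finset.mem_union_right _ (Finset.mem_image_of_mem _ hg)
  let B : Y → Set Y := fun z => ⋂ g ∈ S, {a | dist (g +ᵥ a) (g +ᵥ z) ≤ r}
  have hBc : ∀ z, IsClosed (B z) := fun z => isClosed_biInter fun g _ =>
    isClosed_le ((continuous_const_vadd g).dist continuous_const) continuous_const
  have hBn : ∀ z, B z ∈ 𝓝 z := fun z => (biInter_finset_mem S).2 fun g _ => by
    have h1 : Continuous fun a => dist (g +ᵥ a) (g +ᵥ z) :=
      (continuous_const_vadd g).dist continuous_const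
    exact mem_of_superset ((isOpen_lt h1 continuous_const).mem_nhds
      (by simpa using hr)) fun a (ha : _ < r) => ha.le
  have hB : ∀ z, ∀ a ∈ B z, ∀ g ∈ S, dist (g +ᵥ a) (g +ᵥ z) ≤ r := fun z a ha g hg =>
    mem_iInter₂.1 ha g hg
  have hfar : ∀ z w : Y, ∀ a ∈ B z, ∀ b ∈ B w, ∀ g ∈ S, ∀ h ∈ S, g +ᵥ z ∈ P → h +ᵥ w ∈ P →
      g +ᵥ z ≠ h +ᵥ w → 2 * r ≤ dist (g +ᵥ a) (h +ᵥ b) := by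
    intro z w a ha b hb g hg h hh h1 h2 h3
    have h4 := hrP _ h1 _ h2 h3
    have h5 := hB z a ha g hg
    have h6 := hB w b hb h hh
    have h7 := dist_triangle4 (g +ᵥ z) (g +ᵥ a) (h +ᵥ b) (h +ᵥ w)
    rw [dist_comm (g +ᵥ z) (g +ᵥ a)] at h7
    linarith
  refine ⟨B x ×ˢ B y, prod_mem_nhds (hBn x) (hBn y), (hBc x).isCompact.prod (hBc y).isCompact,
    fun f ε hε => ?_⟩
  -- Recording position as well as value lets one cover control both the oscillation of `f` and the
  -- distances along `S`.
  let φ : Y → S → Y × (Fin 1 → unitInterval) := fun z g => (g.1 +ᵥ z, f (g.1 +ᵥ z))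
  have hφ : Continuous φ := continuous_pi fun g =>
    (continuous_const_vadd g.1).prodMk (f.continuous.comp (continuous_const_vadd g.1))
  obtain ⟨α, hα, hαd⟩ := exists_finiteOpenCover_dist_le hφ (lt_min hr (half_pos hε))
  obtain ⟨β, hβ, hβα, hβd⟩ := hd α hα
  have hosc : ∀ U ∈ β, ∀ a ∈ U, ∀ b ∈ U, ∀ g ∈ S, dist (g +ᵥ a) (g +ᵥ b) ≤ r ∧
      dist (f (g +ᵥ a)) (f (g +ᵥ b)) ≤ ε / 2 := by
    intro U hU a ha b hb g hg
    obtain ⟨V, hV, hUV⟩ := hβα U hU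
    have h1 := (dist_le_pi_dist (φ a) (φ b) ⟨g, hg⟩).trans (hαd V hV a (hUV ha) b (hUV hb))
    have h2 := (le_max_left _ _).trans h1
    have h3 := (le_max_right _ _).trans h1
    exact ⟨h2.trans (min_le_left _ _), h3.trans (min_le_right _ _)⟩
  -- Both neighbourhoods form the base of a single tower, so values over `x` and over `y` are
  -- compared in one general-position system.
  obtain ⟨f', hf', hsep⟩ := exists_perturbation_continuousMap S (C := B x ∪ B y)
    ((hBc x).union (hBc y)) (by
      intro g hg h hh hgh
      rw [disjoint_left]
      rintro _ ⟨a, ha, rfl⟩ ⟨b, hb, hab⟩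
      have h0 : dist (g +ᵥ a) (h +ᵥ b) = 0 := by
        rw [dist_eq_zero]
        exact hab.symm
      rcases ha with ha | ha <;> rcases hb with hb | hb
      · linarith [hfar x x a ha b hb g hg h hh (hPx g hg) (hPx h hh) fun e => hgh (hSx x g h e)]
      · linarith [hfar x y a ha b hb g hg h hh (hPx g hg) (hPy h hh) (hS g hg h hh)]
      · linarith [hfar y x a ha b hb g hg h hh (hPy g hg) (hPx h hh) (hS h hh g hg).symm]
      · linarith [hfar y y a ha b hb g hg h hh (hPy g hg) (hPy h hh) fun e => hgh (hSx y g h e)])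
    hβ hβd (by simp [hScard]) f (half_pos hε)
    (fun U hU a ha b hb g hg => (hosc U hU a ha b hb g hg).2)
  refine ⟨f', by linarith, fun p hp => ?_⟩
  by_contra! hcon
  obtain ⟨U, hU, h1, h2⟩ := hsep p.1 (Or.inl hp.1) p.2 (Or.inr hp.2) fun g _ => hcon g
  obtain ⟨g, hg⟩ : S.Nonempty := Finset.card_pos.1 (by omega)
  have h3 := (hosc U hU _ h1 _ h2 g hg).1
  have h4 := hfar x y p.1 hp.1 p.2 hp.2 g hg g hg (hPx g hg) (hPy g hg) (hS g hg g hg)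
  linarith

/-- A finite-dimensional free `ℤ^k`-action embeds in the shift over the unit interval. -/
theorem exists_orbit_separating_of_coveringDim_lt_top {k : ℕ} (hk : 0 < k) {Y : Type*}
    [MetricSpace Y] [CompactSpace Y] [AddAction (Fin k → ℤ) Y]
    [ContinuousConstVAdd (Fin k → ℤ) Y] (hfree : IsFreeAction k Y) (hdim : coveringDim Y < ⊤) :
    ∃ f : C(Y, Fin 1 → unitInterval), ∀ x y, x ≠ y →
      ∃ g : Fin k → ℤ, f (g +ᵥ x) ≠ f (g +ᵥ y) := by
  choose! K hKn hKc hK using fun (p : Y × Y) (hp : p.1 ≠ p.2) =>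
    exists_nhds_orbit_separating hk hfree hdim hp
  -- The complement of the diagonal is Lindelöf, so countably many of the sets `K p` suffice.
  obtain ⟨t, hts, htc, ht⟩ := TopologicalSpace.countable_cover_nhdsWithin
    (s := {p : Y × Y | p.1 ≠ p.2}) (f := K) fun p hp => mem_nhdsWithin_of_mem_nhds (hKn p hp)
  have := htc.to_subtype
  obtain ⟨f, hf⟩ := exists_forall_orbit_separating (Γ := Fin k → ℤ) (fun p : t => K p)
    (fun p => hKc p (hts p.2)) (fun p => hK p (hts p.2))
  refine ⟨f, fun x y hxy => ?_⟩
  obtain ⟨p, hp, hxyp⟩ := mem_iUnion₂.1 (ht (show (x, y) ∈ {p : Y × Y | p.1 ≠ p.2} from hxy))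
  exact hf ⟨p, hp⟩ (x, y) hxyp

/-! ### Separating points within fibres. -/

theorem card_box (k n : ℕ) : (box k n).card = n ^ k := by
  simp [box]

/-- At the fixed scale `ε` the lower limit is below `L / 2`, so some positive `n` has normalized
width below it. The strict inequality becomes `2 * m + 1 ≤ n ^ k * L`, the room required for general
position. -/
theorem exists_cover_of_meanDim_lt {k L : ℕ} {X : Type*} [MetricSpace X]
    [AddAction (Fin k → ℤ) X] (h : meanDim k X < (L : ℝ≥0∞) / 2) {ε : ℝ} (hε : 0 < ε) :
    ∃ n m : ℕ, 0 < n ∧ 2 * m < n ^ k * L ∧ ∃ α : Set (Set X), IsFiniteOpenCover α ∧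
      (∀ U ∈ α, ∀ x ∈ U, ∀ y ∈ U, ∀ g ∈ box k n, dist (g +ᵥ x) (g +ᵥ y) ≤ ε) ∧
      coverOrder α ≤ ((m : ℕ∞) : WithBot ℕ∞) := by
  have h1 : liminf (fun n : ℕ => ((widim ε (boxDist k n (X := X)) : ℕ∞) : ℝ≥0∞) /
      (n : ℝ≥0∞) ^ k) atTop < (L : ℝ≥0∞) / 2 :=
    lt_of_le_of_lt (le_iSup₂ (f := fun (ε : ℝ) (_ : 0 < ε) => liminf
      (fun n : ℕ => ((widim ε (boxDist k n (X := X)) : ℕ∞) : ℝ≥0∞) / (n : ℝ≥0∞) ^ k) atTop) ε hε) h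
  obtain ⟨n, hn, hn0⟩ := ((frequently_lt_of_liminf_lt (by isBoundedDefault) h1).and_eventually
    (eventually_gt_atTop 0)).exists
  have hnk : ((n : ℝ≥0∞) ^ k) ≠ 0 := pow_ne_zero _ (by exact_mod_cast hn0.ne')
  have hnk' : ((n : ℝ≥0∞) ^ k) ≠ ⊤ := ENNReal.pow_ne_top (ENNReal.natCast_ne_top n)
  rw [ENNReal.div_lt_iff (Or.inl hnk) (Or.inl hnk')] at hn
  have hw : widim ε (boxDist k n (X := X)) ≠ ⊤ := by
    intro e
    rw [e] at hn
    simp at hn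
  obtain ⟨w, hw⟩ := ENat.ne_top_iff_exists.1 hw
  rw [← hw] at hn
  have h2 : 2 * w < n ^ k * L := by
    have h3 : ((w : ℝ≥0∞) * 2) < L / 2 * n ^ k * 2 :=
      ENNReal.mul_lt_mul_left (by simp) (by simp) (by simpa using hn)
    rw [mul_right_comm, ENNReal.div_mul_cancel (by simp) (by simp)] at h3
    have h4 : w * 2 < L * n ^ k := by exact_mod_cast h3
    linarith
  have h5 : widim ε (boxDist k n (X := X)) < ((w + 1 : ℕ) : ℕ∞) := by
    rw [← hw]
    exact_mod_cast Nat.lt_succ_self w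
  obtain ⟨m, hm⟩ := iInf_lt_iff.1 h5
  obtain ⟨⟨α, hα, hαd, hαo⟩, hm'⟩ := iInf_lt_iff.1 hm
  have hmw : m < w + 1 := by exact_mod_cast hm'
  refine ⟨n, m, hn0, by omega, α, hα, fun U hU x hx y hy g hg => ?_, hαo⟩
  refine le_trans ?_ (hαd U hU x hx y hy)
  rw [dist_nndist]
  exact NNReal.coe_le_coe.2 (Finset.le_sup (f := fun g => nndist (g +ᵥ x) (g +ᵥ y)) hg)

theorem hasRokhlinTowers_of_rokhlinDim_eq {k D : ℕ} {Y : Type*} [TopologicalSpace Y]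
    [AddAction (Fin k → ℤ) Y] (h : rokhlinDim k Y = (D : ℕ∞)) : HasRokhlinTowers k Y D := by
  have h1 : rokhlinDim k Y < ((D + 1 : ℕ) : ℕ∞) := by
    rw [h]
    exact_mod_cast Nat.lt_succ_self D
  obtain ⟨d, hd⟩ := iInf_lt_iff.1 h1
  obtain ⟨hd', hdD⟩ := iInf_lt_iff.1 hd
  have h2 : ((D : ℕ) : ℕ∞) ≤ (d : ℕ∞) := by
    rw [← h]
    exact iInf₂_le d hd'
  have h3 : D ≤ d := by exact_mod_cast h2
  have h4 : d < D + 1 := by exact_mod_cast hdD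
  obtain rfl : d = D := by omega
  exact hd'

/-- For an extension of an action with Rokhlin towers, some map into a cube of dimension
`(D + 1) * L` separates the orbits of the points of each fibre. -/
theorem exists_fibre_orbit_separating {k D L : ℕ} {X Y : Type*} [MetricSpace X] [CompactSpace X]
    [AddAction (Fin k → ℤ) X] [ContinuousConstVAdd (Fin k → ℤ) X] [MetricSpace Y]
    [AddAction (Fin k → ℤ) Y] [ContinuousConstVAdd (Fin k → ℤ) Y] {π : X → Y}
    (hπ : IsFactorMap k π) (hmdim : meanDim k X < (L : ℝ≥0∞) / 2) (hD : HasRokhlinTowers k Y D) :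
    ∃ F : C(X, Fin (D + 1) → Fin L → unitInterval), ∀ x y, π x = π y → x ≠ y →
      ∃ g : Fin k → ℤ, F (g +ᵥ x) ≠ F (g +ᵥ y) := by
  -- These compact sets exhaust the pairs of distinct points in a common fibre.
  let K : ℕ → Set (X × X) := fun j => {p | π p.1 = π p.2 ∧ 1 / ((j : ℝ) + 1) ≤ dist p.1 p.2}
  have hK : ∀ j, IsCompact (K j) := fun j =>
    ((isClosed_eq (hπ.continuous.comp continuous_fst) (hπ.continuous.comp continuous_snd)).inter
      (isClosed_le continuous_const continuous_dist)).isCompact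
  obtain ⟨F, hF⟩ := exists_forall_orbit_separating (Γ := Fin k → ℤ)
      (Z := Fin (D + 1) → Fin L → unitInterval) K hK (by
    intro j F ε hε
    have hj : (0 : ℝ) < 1 / ((j : ℝ) + 1) := by positivity
    obtain ⟨η, hη, hunif⟩ := Metric.uniformContinuous_iff.1
      (CompactSpace.uniformContinuous_of_continuous F.continuous) (ε / 2) (half_pos hε)
    -- Scale `η` keeps the oscillation of `F` small, scale `1 / (j + 1)` will contradict the
    -- distance of the pair; halving makes both strict. The same `n` then fixes the tower height.
    obtain ⟨n, m, hn, hmn, α, hα, hαd, hαo⟩ :=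
      exists_cover_of_meanDim_lt hmdim (half_pos (lt_min hη hj))
    have hlt : min η (1 / ((j : ℝ) + 1)) / 2 < min η (1 / ((j : ℝ) + 1)) :=
      half_lt_self (lt_min hη hj)
    obtain ⟨U, hUo, hUd, hUc⟩ := hD n hn
    have hpert : ∀ i, ∃ f' : C(X, Fin L → unitInterval),
        dist f' ((⟨fun z => z i, continuous_apply i⟩ : C(_, _)).comp F) ≤ 2 * (ε / 2) ∧
        ∀ x ∈ π ⁻¹' closure (U i), ∀ y ∈ π ⁻¹' closure (U i),
          (∀ g ∈ box k n, f' (g +ᵥ x) = f' (g +ᵥ y)) → ∃ V ∈ α, x ∈ V ∧ y ∈ V := by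
      intro i
      refine exists_perturbation_continuousMap (box k n) (isClosed_closure.preimage hπ.continuous)
        ?_ hα hαo (by rw [card_box, Fintype.card_fin]; omega) _ (half_pos hε) ?_
      · intro g hg h hh hgh
        rw [disjoint_left]
        rintro _ ⟨a, ha, rfl⟩ ⟨b, hb, hab⟩
        refine disjoint_left.1 (hUd i g hg h hh hgh) ⟨π a, ha, rfl⟩ ⟨π b, hb, ?_⟩
        have := congrArg π hab
        simpa only [hπ.map_vadd] using this
      · intro V hV x hx y hy g hg
        refine (dist_le_pi_dist (F (g +ᵥ x)) (F (g +ᵥ y)) i).trans (hunif ?_).le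
        exact ((hαd V hV x hx y hy g hg).trans_lt hlt).trans_le (min_le_left _ _)
    choose f' hf' hsep using hpert
    refine ⟨⟨fun x i => f' i x, continuous_pi fun i => (f' i).continuous⟩, ?_, ?_⟩
    · refine (ContinuousMap.dist_le hε.le).2 fun x => (dist_pi_le_iff hε.le).2 fun i => ?_
      have := (ContinuousMap.dist_apply_le_dist x).trans (hf' i)
      rw [mul_div_cancel₀ _ (two_ne_zero)] at this
      exact this
    · rintro ⟨x, y⟩ ⟨hxy, hdist⟩
      by_contra! hcon
      have hx : π x ∈ ⋃ i, ⋃ g ∈ box k n, (fun x => g +ᵥ x) '' U i := hUc ▸ mem_univ _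
      obtain ⟨i, hx⟩ := mem_iUnion.1 hx
      obtain ⟨g, hg, z, hz, hgz⟩ := mem_iUnion₂.1 hx
      have hgz : g +ᵥ z = π x := hgz
      -- Towers are pulled back from `Y`, so two points of one fibre enter the base under the same
      -- translate `-g`. Moving back by `g ∈ [n]` stays within the reach of the cover's metric
      -- bound.
      have hmem : ∀ w, π w = π x → -g +ᵥ w ∈ π ⁻¹' closure (U i) := by
        intro w hw
        rw [mem_preimage, hπ.map_vadd, hw, ← hgz, neg_vadd_vadd]
        exact subset_closure hz
      obtain ⟨V, hV, h1, h2⟩ := hsep i _ (hmem x rfl) _ (hmem y hxy.symm) fun h _ => by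
        have := congrFun (hcon (h + -g)) i
        simpa only [add_vadd, ContinuousMap.coe_mk] using this
      have h3 := hαd V hV _ h1 _ h2 g hg
      rw [vadd_neg_vadd, vadd_neg_vadd] at h3
      have := min_le_right η (1 / ((j : ℝ) + 1))
      simp only at hdist
      linarith)
  refine ⟨F, fun x y hxy hne => ?_⟩
  obtain ⟨j, hj⟩ := exists_nat_one_div_lt (dist_pos.2 hne)
  exact hF j (x, y) ⟨hxy, hj.le⟩

end ZkAction

/-! ### Assembling the embedding. -/

theorem mainTheorem5 (k : ℕ) (hk : 0 < k) (D L : ℕ) (hL : 0 < L)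
    {X : Type*} [MetricSpace X] [CompactSpace X]
    [AddAction (Fin k → ℤ) X] [ContinuousConstVAdd (Fin k → ℤ) X]
    {Y : Type*} [MetricSpace Y] [CompactSpace Y]
    [AddAction (Fin k → ℤ) Y] [ContinuousConstVAdd (Fin k → ℤ) Y]
    (π : X → Y) (hπ : ZkAction.IsFactorMap k π)
    (hfree : ZkAction.IsFreeAction k Y)
    (hmdim : ZkAction.meanDim k X < (L : ENNReal) / 2)
    (hRok : ZkAction.rokhlinDim k Y = (D : ℕ∞))
    (hdim : ZkAction.coveringDim Y < ⊤) :
    ∃ f : X → ZkAction.CubicalShift k ((D + 1) * L + 1), ZkAction.IsCubicalEmbedding f := by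
  obtain ⟨h, hh⟩ := ZkAction.exists_orbit_separating_of_coveringDim_lt_top hk hfree hdim
  obtain ⟨F, hF⟩ := ZkAction.exists_fibre_orbit_separating hπ hmdim
    (ZkAction.hasRokhlinTowers_of_rokhlinDim_eq hRok)
  let e : (Fin (D + 1) × Fin L) ⊕ Fin 1 ≃ Fin ((D + 1) * L + 1) :=
    (finProdFinEquiv.sumCongr (Equiv.refl _)).trans finSumFinEquiv
  let f : X → ZkAction.CubicalShift k ((D + 1) * L + 1) := fun x n j =>
    Sum.elim (fun p => F (n +ᵥ x) p.1 p.2) (fun u => h (π (n +ᵥ x)) u) (e.symm j)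
  have hfl : ∀ x n p, f x n (e (Sum.inl p)) = F (n +ᵥ x) p.1 p.2 := fun x n p => by simp [f]
  have hfr : ∀ x n u, f x n (e (Sum.inr u)) = h (π (n +ᵥ x)) u := fun x n u => by simp [f]
  refine ⟨f, ?_, ?_, ?_⟩
  · refine continuous_pi fun n => continuous_pi fun j => ?_
    obtain ⟨s, rfl⟩ := e.surjective j
    rcases s with p | u
    · simp only [hfl]
      exact (continuous_apply p.2).comp ((continuous_apply p.1).comp
        (F.continuous.comp (continuous_const_vadd n)))
    · simp only [hfr]
      exact (continuous_apply u).comp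
        (h.continuous.comp (hπ.continuous.comp (continuous_const_vadd n)))
  · intro x y hxy
    by_contra hne
    by_cases hp : π x = π y
    · obtain ⟨g, hg⟩ := hF x y hp hne
      refine hg (funext fun i => funext fun l => ?_)
      rw [← hfl x g (i, l), ← hfl y g (i, l), hxy]
    · obtain ⟨g, hg⟩ := hh _ _ hp
      refine hg (funext fun u => ?_)
      rw [← hπ.map_vadd, ← hπ.map_vadd, ← hfr, ← hfr, hxy]
  · intro g x
    funext n j
    simp only [f, ZkAction.shift, add_vadd]
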